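/- Let $a,c\in\mathbb{Z}$ and $f(X)=X^5+aX^3+cX$. Assume that $a<0$ and that, whenever $a=4^k b$ with $k\ge 0$ and $b\in\mathbb{Z}$, one has $-b\not\equiv 2,18,34\pmod{48}$ (if $4\nmid a$ this just says $-a\not\equiv 2,18,34\pmod{48}$). Then the equation $$f(p)+f(q)=f(r)+f(s)$$ has a non-trivial two-parametric rational solution: there are rational functions $p,q,r,s\in\mathbb{Q}(u,v)$ in two independent variables $u,v$ such that 1. $f(p)+f(q)=f(r)+f(s)$ holds identically in $\mathbb{Q}(u,v)$; 2. the solution is non-trivial, i.e. $\{p,q\}\cap\{r,s\}=\emptyset$, $\{f(p),f(q)\}\cap\{f(r),f(s)\}=\emptyset$, and $f(p)+f(q)\neq 0$ (in particular it is not one of the obvious solutions with $q=-p$, $s=-r$) as elements of $\mathbb{Q}(u,v)$; 3. $\mathbb{Q}(p,q,r,s)=\mathbb{Q}(u,v)$, so $(u,v)\mapsto(p,q,r,s)$ is birational onto its image, a $\mathbb{Q}$-rational surface contained in the hypersurface $f(p)+f(q)=f(r)+f(s)$. -/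

import Mathlib

open Polynomial

/-- The quintic polynomial `X ^ 5 + a X ^ 3 + c X` with integer coefficients. -/
noncomputable def oddQuintic (a c : ℤ) : ℤ[X] := X ^ 5 + C a * X ^ 3 + C c * X

/-- The field `ℚ(u, v)` of rational functions in two independent parameters. -/
abbrev TwoParamField : Type := FractionRing (MvPolynomial (Fin 2) ℚ)

/-- `(p, q, r, s)` lies on the hypersurface `f(p) + f(q) = f(r) + f(s)`. -/
def OnHypersurface {K : Type*} [Field K] (f : ℤ[X]) (p q r s : K) : Prop :=
  aeval p f + aeval q f = aeval r f + aeval s f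

/-- Non-triviality of a point for an odd polynomial `f`: `{p, q}` and `{r, s}` are disjoint,
`{f(p), f(q)}` and `{f(r), f(s)}` are disjoint, and the common value `f(p) + f(q)` is nonzero.
The last condition excludes the solutions `q = -p`, `s = -r`, which exist because `f` is odd. -/
def NonTrivialPoint {K : Type*} [Field K] (f : ℤ[X]) (p q r s : K) : Prop :=
  Disjoint ({p, q} : Set K) {r, s} ∧
  Disjoint ({aeval p f, aeval q f} : Set K) {aeval r f, aeval s f} ∧
  aeval p f + aeval q f ≠ 0

/-- Four rational functions `p, q, r, s ∈ ℚ(u, v)` form a two-parametric rational solution of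
`f(p) + f(q) = f(r) + f(s)`: the equation holds identically, the solution is non-trivial, and
`ℚ(p, q, r, s) = ℚ(u, v)`, that is, `(u, v) ↦ (p, q, r, s)` is birational onto its image, so that
both parameters are essential and the image is a `ℚ`-rational surface. -/
structure IsTwoParametricSolution (f : ℤ[X]) (p q r s : TwoParamField) : Prop where
  onHypersurface : OnHypersurface f p q r s
  nonTrivial : NonTrivialPoint f p q r s
  birational : IntermediateField.adjoin ℚ ({p, q, r, s} : Set TwoParamField) = ⊤

/-! Put p, q = t ± x and r, s = t ± y. Then f(p)+f(q)-f(r)-f(s) = 2t(x²-y²)(10t²+5x²+5y²+3a), so the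
quadric 10t²+5x²+5y² = -3a lies on the hypersurface, and c plays no role. One rational point on it
gives a birational parametrization by (u, v).

Such a point amounts to writing -15a as x²+y²+2z² over ℚ. After removing powers of 4, the hypothesis
excludes exactly the 2-adic obstruction -b ≡ 2 (mod 16). Dirichlet's theorem supplies an auxiliary
prime q ≡ 1 (mod 4), a sum of two squares, which reduces the ternary problem to a Legendre equation
(`exists_ternary_solution`) made solvable by reciprocity.

Non-triviality is a dimension count: a forbidden coincidence would make t, x, y algebraic over a
single element, but ℚ(u, v) has transcendence degree 2. -/

/-! ### Legendre's equation. -/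

/-- Pigeonhole: three linear congruences modulo `A`, `B`, `C` have a nonzero common solution whose
coordinates are bounded by `√(AC)`, `√(BC)`, `√(AB)`. -/
theorem exists_small_solution_of_congruences {A B C : ℕ} (hA : 0 < A) (hB : 0 < B) (hC : 0 < C)
    (α β γ : ℤ) :
    ∃ X Y Z : ℤ, ¬ (X = 0 ∧ Y = 0 ∧ Z = 0) ∧
      (A : ℤ) ∣ Z - β * X ∧ (B : ℤ) ∣ Z - α * Y ∧ (C : ℤ) ∣ X - γ * Y ∧
      X ^ 2 ≤ A * C ∧ Y ^ 2 ≤ B * C ∧ Z ^ 2 ≤ A * B := by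
  have : NeZero A := ⟨hA.ne'⟩
  have : NeZero B := ⟨hB.ne'⟩
  have : NeZero C := ⟨hC.ne'⟩
  let box : Finset (ℕ × ℕ × ℕ) := Finset.range (Nat.sqrt (A * C) + 1) ×ˢ
    Finset.range (Nat.sqrt (B * C) + 1) ×ˢ Finset.range (Nat.sqrt (A * B) + 1)
  let φ : ℕ × ℕ × ℕ → ZMod A × ZMod B × ZMod C := fun w =>
    (((w.2.2 - β * w.1 : ℤ) : ZMod A), ((w.2.2 - α * w.2.1 : ℤ) : ZMod B),
      ((w.1 - γ * w.2.1 : ℤ) : ZMod C))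
  -- There are ABC residue triples, while the box has more than √(AC)·√(BC)·√(AB) = ABC points;
  -- squares are compared.
  have hcard : (Finset.univ : Finset (ZMod A × ZMod B × ZMod C)).card < box.card := by
    simp only [box, Finset.card_univ, Fintype.card_prod, ZMod.card, Finset.card_product,
      Finset.card_range]
    have h1 := Nat.lt_succ_sqrt (A * C)
    have h2 := Nat.lt_succ_sqrt (B * C)
    have h3 := Nat.lt_succ_sqrt (A * B)
    refine Nat.mul_self_lt_mul_self_iff.mp ?_
    calc A * (B * C) * (A * (B * C)) = (A * C) * ((B * C) * (A * B)) := by ring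
      _ < _ := Nat.mul_lt_mul'' h1 (Nat.mul_lt_mul'' h2 h3)
      _ = _ := by simp only [Nat.succ_eq_add_one]; ring
  obtain ⟨⟨x, y, z⟩, h1, ⟨x', y', z'⟩, h2, hne, heq⟩ :=
    Finset.exists_ne_map_eq_of_card_lt_of_maps_to hcard (f := φ) (fun _ _ => Finset.mem_univ _)
  simp only [box, Finset.mem_product, Finset.mem_range, Nat.lt_succ_iff] at h1 h2
  simp only [φ, Prod.mk.injEq, ZMod.intCast_eq_intCast_iff_dvd_sub] at heq
  have bound : ∀ {u v n : ℕ}, u ≤ Nat.sqrt n → v ≤ Nat.sqrt n →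
      ((u : ℤ) - v) ^ 2 ≤ n := by
    intro u v n hu hv
    have hs : ((Nat.sqrt n : ℕ) : ℤ) * Nat.sqrt n ≤ n := by exact_mod_cast Nat.sqrt_le n
    have : |(u : ℤ) - v| ≤ Nat.sqrt n := by rw [abs_le]; omega
    nlinarith [sq_le_sq' (abs_le.mp this).1 (abs_le.mp this).2]
  refine ⟨(x' : ℤ) - x, (y' : ℤ) - y, (z' : ℤ) - z, ?_, ?_, ?_, ?_, ?_, ?_, ?_⟩
  · rintro ⟨hx, hy, hz⟩
    apply hne
    simp only [Prod.mk.injEq]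
    omega
  · convert heq.1 using 1; ring
  · convert heq.2.1 using 1; ring
  · convert heq.2.2 using 1; ring
  · exact_mod_cast bound h2.1 h1.1
  · exact_mod_cast bound h2.2.1 h1.2.1
  · exact_mod_cast bound h2.2.2 h1.2.2

/-- A form of Legendre's theorem on the ternary quadratic equation `A Y² = B X² + C Z²`. -/
theorem exists_ternary_solution {A B C : ℕ} (hA : 0 < A) (hB : 0 < B) (hC : 0 < C)
    (hAB : A.Coprime B) (hAC : A.Coprime C) (hBC : B.Coprime C) (hsq : ¬ IsSquare (B * C))
    {α β γ : ℤ} (hβ : (A : ℤ) ∣ B + C * β ^ 2) (hα : (B : ℤ) ∣ A - C * α ^ 2)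
    (hγ : (C : ℤ) ∣ A - B * γ ^ 2) :
    ∃ X Y Z : ℤ, Y ≠ 0 ∧ A * Y ^ 2 = B * X ^ 2 + C * Z ^ 2 := by
  obtain ⟨X, Y, Z, hne, hdA, hdB, hdC, hX, hY, hZ⟩ :=
    exists_small_solution_of_congruences hA hB hC α β γ
  have hA' : (0 : ℤ) < A := by exact_mod_cast hA
  have hB' : (0 : ℤ) < B := by exact_mod_cast hB
  have hC' : (0 : ℤ) < C := by exact_mod_cast hC
  have hsq' : ∀ w : ℤ, w ^ 2 ≠ B * C := by
    intro w hw
    apply hsq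
    refine ⟨w.natAbs, ?_⟩
    zify
    rw [← hw, abs_mul_abs_self, sq]
  have dA : (A : ℤ) ∣ A * Y ^ 2 - B * X ^ 2 - C * Z ^ 2 := by
    obtain ⟨k, hk⟩ := hdA
    obtain ⟨l, hl⟩ := hβ
    refine ⟨Y ^ 2 - l * X ^ 2 - C * k * (Z + β * X), ?_⟩
    linear_combination (-X ^ 2) * hl - C * (Z + β * X) * hk
  have dB : (B : ℤ) ∣ A * Y ^ 2 - B * X ^ 2 - C * Z ^ 2 := by
    obtain ⟨k, hk⟩ := hdB
    obtain ⟨l, hl⟩ := hα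
    refine ⟨l * Y ^ 2 - X ^ 2 - C * k * (Z + α * Y), ?_⟩
    linear_combination (Y ^ 2) * hl - C * (Z + α * Y) * hk
  have dC : (C : ℤ) ∣ A * Y ^ 2 - B * X ^ 2 - C * Z ^ 2 := by
    obtain ⟨k, hk⟩ := hdC
    obtain ⟨l, hl⟩ := hγ
    refine ⟨l * Y ^ 2 - Z ^ 2 - B * k * (X + γ * Y), ?_⟩
    linear_combination (Y ^ 2) * hl - B * (X + γ * Y) * hk
  have cAB : IsCoprime (A : ℤ) B := Nat.isCoprime_iff_coprime.mpr hAB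
  have cAC : IsCoprime (A : ℤ) C := Nat.isCoprime_iff_coprime.mpr hAC
  have cBC : IsCoprime (B : ℤ) C := Nat.isCoprime_iff_coprime.mpr hBC
  -- AY²-BX²-CZ² = kABC. The size bounds give -2 ≤ k ≤ 1, and either extreme would make BC a square.
  obtain ⟨k, hk⟩ := (cAC.mul_left cBC).mul_dvd (cAB.mul_dvd dA dB) dC
  have hP : (0 : ℤ) < A * B * C := by positivity
  have mX : (B : ℤ) * X ^ 2 ≤ A * B * C := by nlinarith
  have mY : (A : ℤ) * Y ^ 2 ≤ A * B * C := by nlinarith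
  have mZ : (C : ℤ) * Z ^ 2 ≤ A * B * C := by nlinarith
  have nX : 0 ≤ (B : ℤ) * X ^ 2 := by positivity
  have nY : 0 ≤ (A : ℤ) * Y ^ 2 := by positivity
  have nZ : 0 ≤ (C : ℤ) * Z ^ 2 := by positivity
  have hk1 : k < 1 := by
    by_contra! h
    have : (A : ℤ) * B * C ≤ A * B * C * k := by nlinarith
    have h1 : (A : ℤ) * Y ^ 2 = A * (B * C) := by linarith
    exact hsq' Y (mul_left_cancel₀ hA'.ne' h1)
  have hk2 : -2 < k := by
    by_contra! h
    have : (A : ℤ) * B * C * k ≤ A * B * C * (-2) := by nlinarith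
    have h1 : (B : ℤ) * X ^ 2 = B * (A * C) := by linarith
    have h2 : (C : ℤ) * Z ^ 2 = C * (A * B) := by linarith
    have h1 := mul_left_cancel₀ hB'.ne' h1
    have h2 := mul_left_cancel₀ hC'.ne' h2
    have h3 : (X * Z) ^ 2 = A ^ 2 * ((B : ℤ) * C) := by rw [mul_pow, h1, h2]; ring
    obtain ⟨w, hw⟩ : (A : ℤ) ∣ X * Z := (Int.pow_dvd_pow_iff two_ne_zero).mp ⟨_, h3⟩
    rw [hw, mul_pow] at h3
    exact hsq' w (mul_left_cancel₀ (by positivity) h3)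
  obtain rfl | rfl : k = 0 ∨ k = -1 := by omega
  · refine ⟨X, Y, Z, ?_, by linarith⟩
    rintro rfl
    apply hne
    have h1 : (B : ℤ) * X ^ 2 = 0 := by linarith
    have h2 : (C : ℤ) * Z ^ 2 = 0 := by linarith
    simpa [hB.ne', hC.ne'] using And.intro h1 h2
  -- Multiply AY²+ABC = BX²+CZ² by the norm Y²+BC; the right side keeps its shape.
  · refine ⟨X * Y - C * Z, Y ^ 2 + B * C, Z * Y + B * X, by positivity, ?_⟩
    linear_combination (Y ^ 2 + B * C) * hk

/-! ### Auxiliary primes and rational sums of squares. -/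

/-- Dirichlet's theorem with the residue modulo `8` prescribed separately. -/
theorem exists_prime_mod_eight {n r e : ℕ} (hn : Odd n) (hr : r.Coprime n) (he : Odd e) :
    ∃ q : ℕ, q.Prime ∧ q ≡ e [MOD 8] ∧ q ≡ r [MOD n] := by
  have h8 : Nat.Coprime 8 n := by
    simpa using (Nat.coprime_two_left.mpr hn).pow_left 3
  obtain ⟨k, hk8, hkn⟩ := Nat.chineseRemainder h8 e r
  have hk : k.Coprime (8 * n) := by
    refine Nat.Coprime.mul_right ?_ ?_
    · unfold Nat.Coprime
      rw [hk8.gcd_eq]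
      simpa using (Nat.coprime_two_right.mpr he).pow_right 3
    · unfold Nat.Coprime
      rw [hkn.gcd_eq]
      exact hr
  obtain ⟨q, -, hq, hqk⟩ := Nat.forall_exists_prime_gt_and_modEq 0
    (by have := hn.pos; positivity) hk
  exact ⟨q, hq, (hqk.of_mul_right n).trans hk8, (hqk.of_mul_left 8).trans hkn⟩

/-- A square modulo a prime, in terms of divisibility. -/
theorem exists_dvd_sub_sq_of_jacobiSym_eq_one {q : ℕ} (hq : q.Prime) {a : ℤ}
    (h : jacobiSym a q = 1) : ∃ w : ℤ, (q : ℤ) ∣ a - w ^ 2 := by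
  have : Fact q.Prime := ⟨hq⟩
  obtain ⟨w, hw⟩ := ZMod.isSquare_of_jacobiSym_eq_one h
  obtain ⟨w, rfl⟩ := ZMod.intCast_surjective w
  refine ⟨w, ?_⟩
  rw [← ZMod.intCast_zmod_eq_zero_iff_dvd]
  push_cast
  rw [hw]; ring

/-- Reciprocity for a prime `q ≡ 1 (mod 4)` satisfying `d q ≡ 1 (mod n)`. -/
theorem jacobiSym_eq_of_dvd_mul_sub_one {n q : ℕ} {d : ℤ} (hn : Odd n) (hq : q % 4 = 1)
    (h : (n : ℤ) ∣ d * q - 1) : jacobiSym n q = jacobiSym d n := by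
  rw [← jacobiSym.quadratic_reciprocity_one_mod_four hq hn]
  have h1 : jacobiSym (d * q) n = 1 := by
    rw [jacobiSym.mod_left' (a₂ := 1) (Int.emod_eq_emod_iff_emod_sub_eq_zero.mpr
      (Int.emod_eq_zero_of_dvd h))]
    exact jacobiSym.one_left n
  rw [jacobiSym.mul_left] at h1
  exact (Int.eq_of_mul_eq_one h1).symm

/-- An odd natural number is rationally represented by `x² + y² + 2 z²`. -/
theorem exists_rat_sq_add_sq_add_two_mul_sq_of_odd {n : ℕ} (hn : Odd n) :
    ∃ x y z : ℚ, x ^ 2 + y ^ 2 + 2 * z ^ 2 = n := by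
  -- The class e of q mod 8 makes (2/q) = (-2/n), hence (2n/q) = 1; both choices keep q ≡ 1 (mod 4).
  obtain ⟨e, he1, he2⟩ : ∃ e : ℕ, (e = 1 ∨ e = 5) ∧ ZMod.χ₈ e = jacobiSym (-2) n := by
    have hc : Int.gcd (-2) n = 1 := Nat.coprime_two_left.mpr hn
    rcases jacobiSym.eq_one_or_neg_one hc with h | h
    · exact ⟨1, Or.inl rfl, by rw [h]; decide⟩
    · exact ⟨5, Or.inr rfl, by rw [h]; decide⟩
  obtain ⟨m, rfl⟩ := id hn
  have hr : Nat.Coprime m (2 * m + 1) := by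
    simp [Nat.coprime_mul_right_add_right]
  -- With n = 2m+1, the residue m is the inverse of -2 mod n.
  obtain ⟨q, hq, hq8, hqn⟩ := exists_prime_mod_eight hn hr (e := e)
    (by rcases he1 with rfl | rfl <;> decide)
  have hq4 : q % 4 = 1 := by
    unfold Nat.ModEq at hq8
    rcases he1 with rfl | rfl <;> omega
  have hqo : Odd q := Nat.odd_iff.mpr (by omega)
  have hd : ((2 * m + 1 : ℕ) : ℤ) ∣ -2 * q - 1 := by
    obtain ⟨k, hk⟩ := (Nat.modEq_iff_dvd.mp hqn)
    refine ⟨2 * k - 1, ?_⟩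
    push_cast at hk ⊢
    linear_combination 2 * hk
  have hJ : jacobiSym (2 * (2 * m + 1 : ℕ)) q = 1 := by
    rw [jacobiSym.mul_left, jacobiSym_eq_of_dvd_mul_sub_one hn hq4 hd, jacobiSym.at_two hqo, ← he2]
    have : (q : ZMod 8) = e := (ZMod.natCast_eq_natCast_iff _ _ _).mpr hq8
    rw [this]
    rcases he1 with rfl | rfl <;> decide
  obtain ⟨w, hw⟩ := exists_dvd_sub_sq_of_jacobiSym_eq_one hq hJ
  have : Fact q.Prime := ⟨hq⟩
  obtain ⟨g, h, hgh⟩ := Nat.Prime.sq_add_sq (p := q) (by omega)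
  obtain ⟨j, rfl⟩ := id hqo
  have cop : (2 * m + 1).Coprime (2 * j + 1) := by
    rw [← Nat.isCoprime_iff_coprime]
    obtain ⟨k, hk⟩ := hd
    exact ⟨-k, -2, by linear_combination hk⟩
  have hsq : ¬ IsSquare ((2 * j + 1) * 2) := by
    rintro ⟨k, hk⟩
    have h2 : 2 ∣ k := by
      have : 2 ∣ k * k := ⟨2 * j + 1, by linarith⟩
      exact (Nat.prime_two.dvd_mul.mp this).elim id id
    obtain ⟨l, rfl⟩ := h2
    have : 2 * j + 1 = 2 * (l * l) := by linarith
    omega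
  have hβ : ((2 * m + 1 : ℕ) : ℤ) ∣ (2 * j + 1 : ℕ) + (2 : ℕ) * (2 * j + 1 : ℤ) ^ 2 := by
    obtain ⟨k, hk⟩ := hd
    refine ⟨-k * (2 * j + 1), ?_⟩
    push_cast at hk ⊢
    linear_combination (-(2 * (j : ℤ) + 1)) * hk
  -- Here q = 2j+1, so j+1 inverts 2 mod q, and w² ≡ 2n gives 2(w/2)² ≡ n.
  have hα : ((2 * j + 1 : ℕ) : ℤ) ∣ (2 * m + 1 : ℕ) - (2 : ℕ) * (w * (j + 1)) ^ 2 := by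
    obtain ⟨k, hk⟩ := hw
    push_cast at hk ⊢
    refine ⟨2 * (j + 1) ^ 2 * k - (2 * m + 1) * (2 * j + 3), ?_⟩
    linear_combination 2 * ((j : ℤ) + 1) ^ 2 * hk
  have hγ : ((2 : ℕ) : ℤ) ∣ (2 * m + 1 : ℕ) - (2 * j + 1 : ℕ) * (1 : ℤ) ^ 2 :=
    ⟨(m : ℤ) - j, by push_cast; ring⟩
  obtain ⟨X, Y, Z, hY, hXYZ⟩ := exists_ternary_solution (by omega) (by omega) two_pos cop
    (Nat.coprime_two_right.mpr hn) (Nat.coprime_two_right.mpr hqo) hsq hβ hα hγ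
  have hY' : (Y : ℚ) ≠ 0 := by exact_mod_cast hY
  have hXY : ((2 * m + 1 : ℕ) : ℚ) * Y ^ 2 = ((g : ℚ) ^ 2 + h ^ 2) * X ^ 2 + 2 * Z ^ 2 := by
    have : ((g : ℚ) ^ 2 + h ^ 2) = ((2 * j + 1 : ℕ) : ℚ) := by exact_mod_cast hgh
    rw [this]; exact_mod_cast hXYZ
  refine ⟨g * X / Y, h * X / Y, Z / Y, ?_⟩
  field_simp
  linear_combination -hXY

/-- If `d` is a sum of two squares, `-d` is a square modulo `m` and `m` is a square modulo `d`,
then `m` is a sum of three rational squares. -/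
theorem exists_rat_three_squares_of_dvd {m d : ℕ} (hm : 0 < m) (hd : 0 < d) (hmd : m.Coprime d)
    (hsq : ¬ IsSquare d) {α β : ℤ} (hβ : (m : ℤ) ∣ d + β ^ 2) (hα : (d : ℤ) ∣ m - α ^ 2)
    {g h : ℕ} (hgh : g ^ 2 + h ^ 2 = d) : ∃ x y z : ℚ, x ^ 2 + y ^ 2 + z ^ 2 = m := by
  obtain ⟨X, Y, Z, hY, hXYZ⟩ := exists_ternary_solution (C := 1) hm hd one_pos hmd
    (Nat.coprime_one_right m) (Nat.coprime_one_right d) (by simpa using hsq)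
    (α := α) (β := β) (γ := 0) (by simpa using hβ) (by simpa using hα) (by simp)
  have hY' : (Y : ℚ) ≠ 0 := by exact_mod_cast hY
  have hXY : (m : ℚ) * Y ^ 2 = ((g : ℚ) ^ 2 + h ^ 2) * X ^ 2 + Z ^ 2 := by
    have : ((g : ℚ) ^ 2 + h ^ 2) = (d : ℚ) := by exact_mod_cast hgh
    rw [this]
    have : (m : ℤ) * Y ^ 2 = d * X ^ 2 + Z ^ 2 := by simpa using hXYZ
    exact_mod_cast this
  refine ⟨g * X / Y, h * X / Y, Z / Y, ?_⟩
  field_simp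
  linear_combination -hXY

/-- The three squares theorem over `ℚ` for `m ≡ 1 (mod 4)`. -/
theorem exists_rat_three_squares_of_mod_four {m : ℕ} (hm : m % 4 = 1) :
    ∃ x y z : ℚ, x ^ 2 + y ^ 2 + z ^ 2 = m := by
  have hmo : Odd m := Nat.odd_iff.mpr (by omega)
  -- q ≡ -1 (mod m) makes (m/q) = (-1/m) = 1; then d = q and β = 1 work.
  obtain ⟨q, hq, hq8, hqm⟩ := exists_prime_mod_eight (r := m - 1) (e := 1) hmo
    (by rw [Nat.coprime_self_sub_left (by omega)]; exact Nat.coprime_one_left m) odd_one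
  have hq4 : q % 4 = 1 := by unfold Nat.ModEq at hq8; omega
  have hd : (m : ℤ) ∣ -1 * q - 1 := by
    obtain ⟨k, hk⟩ := Nat.modEq_iff_dvd.mp hqm
    refine ⟨k - 1, ?_⟩
    push_cast [show 1 ≤ m by omega] at hk
    linear_combination hk
  have hJ : jacobiSym m q = 1 := by
    rw [jacobiSym_eq_of_dvd_mul_sub_one hmo hq4 hd, jacobiSym.at_neg_one hmo]
    exact ZMod.χ₄_nat_one_mod_four hm
  obtain ⟨w, hw⟩ := exists_dvd_sub_sq_of_jacobiSym_eq_one hq hJ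
  have : Fact q.Prime := ⟨hq⟩
  obtain ⟨g, h, hgh⟩ := Nat.Prime.sq_add_sq (p := q) (by omega)
  obtain ⟨k, hk⟩ := hd
  refine exists_rat_three_squares_of_dvd (by omega) hq.pos ?_ ?_ (β := 1) ⟨-k, ?_⟩ hw hgh
  · rw [← Nat.isCoprime_iff_coprime]
    exact ⟨-k, -1, by linear_combination hk⟩
  · exact fun hs => hq.prime.irreducible.not_isSquare hs
  · linear_combination -hk

/-- The three squares theorem over `ℚ` for `m ≡ 3 (mod 8)`. -/
theorem exists_rat_three_squares_of_mod_eight {m : ℕ} (hm : m % 8 = 3) :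
    ∃ x y z : ℚ, x ^ 2 + y ^ 2 + z ^ 2 = m := by
  have hmo : Odd m := Nat.odd_iff.mpr (by omega)
  obtain ⟨l, hl⟩ := id hmo
  obtain ⟨q, hq, hq8, hqm⟩ := exists_prime_mod_eight (r := l) (e := 1) hmo
    (by rw [hl]; simp [Nat.coprime_mul_right_add_right]) odd_one
  have hq4 : q % 4 = 1 := by unfold Nat.ModEq at hq8; omega
  have hd : (m : ℤ) ∣ -2 * q - 1 := by
    obtain ⟨k, hk⟩ := Nat.modEq_iff_dvd.mp hqm
    refine ⟨2 * k - 1, ?_⟩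
    have hl' : (m : ℤ) = 2 * l + 1 := by exact_mod_cast hl
    linear_combination 2 * hk + hl'
  have hJ : jacobiSym m q = 1 := by
    rw [jacobiSym_eq_of_dvd_mul_sub_one hmo hq4 hd, jacobiSym.at_neg_two hmo,
      ZMod.χ₈'_nat_eq_if_mod_eight]
    simp [hm, Nat.odd_iff.mp hmo]
  -- Here d = 2q, so the root w must also be odd; adding q to an even root fixes its parity.
  obtain ⟨w, hw, hwo⟩ : ∃ w : ℤ, (q : ℤ) ∣ m - w ^ 2 ∧ (2 : ℤ) ∣ m - w ^ 2 := by
    obtain ⟨w, hw⟩ := exists_dvd_sub_sq_of_jacobiSym_eq_one hq hJ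
    obtain ⟨i, hi⟩ : Odd (m : ℤ) := by exact_mod_cast hmo
    obtain ⟨j, hj⟩ : Odd (q : ℤ) := by exact_mod_cast (Nat.odd_iff.mpr (by omega) : Odd q)
    rcases Int.even_or_odd' w with ⟨v, rfl | rfl⟩
    · refine ⟨2 * v + q, ?_, ?_⟩
      · obtain ⟨k, hk⟩ := hw
        exact ⟨k - 4 * v - q, by linear_combination hk⟩
      · rw [hi, hj]
        exact ⟨i - 2 * j ^ 2 - 2 * v ^ 2 - 4 * v * j - 2 * v - 2 * j, by ring⟩
    · exact ⟨_, hw, i - 2 * v ^ 2 - 2 * v, by rw [hi]; ring⟩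
  have : Fact q.Prime := ⟨hq⟩
  obtain ⟨g, h, hgh⟩ := Nat.Prime.sq_add_sq (p := q) (by omega)
  obtain ⟨k, hk⟩ := hd
  have hc2 : IsCoprime (2 : ℤ) q := by
    have := (Nat.coprime_two_left (n := q)).mpr (Nat.odd_iff.mpr (by omega))
    exact_mod_cast Nat.isCoprime_iff_coprime.mpr this
  have hgh' : (g + h) ^ 2 + (g - h : ℤ).natAbs ^ 2 = 2 * q := by
    zify
    rw [sq_abs]
    have : (g : ℤ) ^ 2 + h ^ 2 = q := by exact_mod_cast hgh
    linear_combination 2 * this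
  refine exists_rat_three_squares_of_dvd (d := 2 * q) (by omega) (by have := hq.pos; omega) ?_ ?_
    (α := w) (β := 1) ⟨-k, ?_⟩ (by push_cast; exact hc2.mul_dvd hwo hw) hgh'
  · rw [← Nat.isCoprime_iff_coprime]
    exact ⟨-k, -1, by push_cast; linear_combination hk⟩
  · rintro ⟨j, hj⟩
    have h2 : 2 ∣ j := by
      have : 2 ∣ j * j := ⟨q, hj.symm⟩
      exact (Nat.prime_two.dvd_mul.mp this).elim id id
    obtain ⟨i, rfl⟩ := h2
    have : q = 2 * (i * i) := by linarith
    omega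
  · push_cast
    linear_combination -hk

/-! ### A rational point on the quadric. -/

/-- Rational points on the quadric `x² + y² + 2 t² = -3a/5`. -/
theorem exists_rat_point_on_quadric {a : ℤ} (ha : a < 0)
    (hmod : ∀ (k : ℕ) (b : ℤ), a = 4 ^ k * b → ¬ -b ≡ 2 [ZMOD 16]) :
    ∃ t x y : ℚ, 10 * t ^ 2 + 5 * x ^ 2 + 5 * y ^ 2 = -3 * a := by
  obtain ⟨k, b, hb, hab⟩ := Nat.exists_eq_pow_mul_and_not_dvd
    (n := a.natAbs) (by omega) 4 (by norm_num)
  have hab' : a = 4 ^ k * -(b : ℤ) := by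
    have : (a.natAbs : ℤ) = 4 ^ k * b := by exact_mod_cast hab
    rw [mul_neg, ← this]; omega
  have hb16 := hmod k _ hab'
  rw [neg_neg] at hb16
  unfold Int.ModEq at hb16
  obtain ⟨x, y, z, h⟩ : ∃ x y z : ℚ, x ^ 2 + y ^ 2 + 2 * z ^ 2 = (15 * b : ℕ) := by
    rcases Nat.even_or_odd' b with ⟨m, rfl | rfl⟩
    · obtain ⟨x, y, z, h⟩ : ∃ x y z : ℚ, x ^ 2 + y ^ 2 + z ^ 2 = (15 * m : ℕ) := by
        -- 4 ∤ b makes m odd, and b ≢ 2 (mod 16) excludes 15m ≡ 7 (mod 8).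
        rcases (by omega : (15 * m) % 4 = 1 ∨ (15 * m) % 8 = 3) with h | h
        · exact exists_rat_three_squares_of_mod_four h
        · exact exists_rat_three_squares_of_mod_eight h
      refine ⟨x + y, x - y, z, ?_⟩
      push_cast at h ⊢
      linear_combination 2 * h
    · exact exists_rat_sq_add_sq_add_two_mul_sq_of_odd ⟨15 * m + 7, by ring⟩
  refine ⟨2 ^ k * z / 5, 2 ^ k * x / 5, 2 ^ k * y / 5, ?_⟩
  have h4 : (4 : ℚ) ^ k = (2 ^ k) ^ 2 := by rw [← pow_mul, mul_comm, pow_mul]; norm_num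
  rw [hab']
  push_cast at h ⊢
  rw [h4]
  linear_combination (2 ^ k) ^ 2 / 5 * h

/-! ### Generators and transcendence degree of ℚ(u, v). -/

/-- An intermediate field of `ℚ(u, v) / ℚ` containing both parameters is everything. -/
theorem TwoParamField.eq_top_of_mem {E : IntermediateField ℚ TwoParamField}
    (h : ∀ i, algebraMap (MvPolynomial (Fin 2) ℚ) TwoParamField (MvPolynomial.X i) ∈ E) :
    E = ⊤ := by
  have hpoly : ∀ P : MvPolynomial (Fin 2) ℚ, algebraMap _ TwoParamField P ∈ E := by
    intro P
    induction P using MvPolynomial.induction_on with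
    | C r =>
      have : algebraMap _ TwoParamField (MvPolynomial.C r : MvPolynomial (Fin 2) ℚ) =
          algebraMap ℚ TwoParamField r := by
        rw [IsScalarTower.algebraMap_apply ℚ (MvPolynomial (Fin 2) ℚ) TwoParamField]
        rfl
      rw [this]
      exact E.algebraMap_mem r
    | add P Q hP hQ => rw [map_add]; exact add_mem hP hQ
    | mul_X P i hP => rw [map_mul]; exact mul_mem hP (h i)
  refine eq_top_iff.mpr fun w _ => ?_
  obtain ⟨P, Q, -, rfl⟩ := IsFractionRing.div_surjective (A := MvPolynomial (Fin 2) ℚ) w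
  exact div_mem (hpoly P) (hpoly Q)

/-- `ℚ(u, v)` is not algebraic over a subalgebra with one generator. -/
theorem TwoParamField.not_isAlgebraic_adjoin_singleton (w : TwoParamField) :
    ¬ Algebra.IsAlgebraic (Algebra.adjoin ℚ {w}) TwoParamField := by
  intro h
  have h1 := Algebra.IsAlgebraic.trdeg_le_cardinalMk ℚ ({w} : Set TwoParamField)
  have h2 := trdeg_le_of_injective (IsScalarTower.toAlgHom ℚ (MvPolynomial (Fin 2) ℚ) TwoParamField)
    (IsFractionRing.injective _ _)
  rw [MvPolynomial.trdeg_of_isDomain] at h2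
  have h3 := h2.trans h1
  simp at h3

/-- Generators of `ℚ(u, v)` are not all algebraic over a subalgebra with one generator. -/
theorem TwoParamField.exists_not_isAlgebraic {S : Set TwoParamField}
    (hS : IntermediateField.adjoin ℚ S = ⊤) (w : TwoParamField) :
    ∃ z ∈ S, ¬ IsAlgebraic (Algebra.adjoin ℚ {w}) z := by
  by_contra! h
  refine TwoParamField.not_isAlgebraic_adjoin_singleton w ⟨fun z => ?_⟩
  have hz : z ∈ IntermediateField.adjoin ℚ S := hS ▸ IntermediateField.mem_top
  induction hz using IntermediateField.adjoin_induction with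
  | mem z hz => exact h z hz
  | algebraMap r =>
    rw [IsScalarTower.algebraMap_apply ℚ (Algebra.adjoin ℚ {w}) TwoParamField]
    exact isAlgebraic_algebraMap _
  | add _ _ _ _ h1 h2 => exact h1.add h2
  | inv _ _ h1 => exact h1.inv
  | mul _ _ _ _ h1 h2 => exact h1.mul h2

/-! ### Non-triviality by algebraic dependence. -/

theorem aeval_oddQuintic {K : Type*} [Field K] (a c : ℤ) (w : K) :
    aeval w (oddQuintic a c) = w ^ 5 + a * w ^ 3 + c * w := by
  simp [oddQuintic]

theorem oddQuintic_monic (a c : ℤ) : (oddQuintic a c).Monic := by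
  unfold oddQuintic; monicity!

theorem oddQuintic_natDegree (a c : ℤ) : (oddQuintic a c).natDegree = 5 := by
  unfold oddQuintic; compute_degree!

section Algebraic

variable {R K : Type*} [CommRing R] [IsDomain R] [Field K] [Algebra R K]

/-- w is a root of the non-constant polynomial f(X) - f(w). Thus equal values of f force algebraic
dependence of the arguments. -/
theorem isAlgebraic_of_aeval_oddQuintic {a c : ℤ} {w : K}
    (h : IsAlgebraic R (aeval w (oddQuintic a c))) : IsAlgebraic R w := by
  have hm := (oddQuintic_monic a c).map (Int.castRingHom R)
  refine IsAlgebraic.of_aeval ((oddQuintic a c).map (Int.castRingHom R)) ?_ ?_ ?_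
  · rw [(oddQuintic_monic a c).natDegree_map, oddQuintic_natDegree]; norm_num
  · rw [hm.leadingCoeff]; exact one_mem _
  · convert h using 1
    rw [aeval_def, eval₂_map, aeval_def]
    congr 1
    exact RingHom.ext_int _ _

variable [CharZero K] {a c : ℤ} {t x y : K}

/-- On the quadric, all coordinates are algebraic as soon as `t + x` and `t + y` are. -/
theorem isAlgebraic_of_quadric (hq : 10 * t ^ 2 + 5 * x ^ 2 + 5 * y ^ 2 = -3 * a)
    (hp : IsAlgebraic R (t + x)) (hr : IsAlgebraic R (t + y)) :
    IsAlgebraic R t ∧ IsAlgebraic R x ∧ IsAlgebraic R y := by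
  -- In terms of P = t+x and R = t+y the quadric is quadratic in t; this completes the square.
  have hsq : (20 * t - 5 * ((t + x) + (t + y))) ^ 2 =
      25 * ((t + x) + (t + y)) ^ 2 - 100 * (t + x) ^ 2 - 100 * (t + y) ^ 2 - 60 * a := by
    linear_combination 20 * hq
  have hn : ∀ n : ℕ, IsAlgebraic R (n : K) := fun n => by
    simpa using isAlgebraic_algebraMap (R := R) (A := K) (n : R)
  have hz : ∀ n : ℤ, IsAlgebraic R (n : K) := isAlgebraic_intCast
  have h1 : IsAlgebraic R (20 * t - 5 * ((t + x) + (t + y))) := by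
    refine IsAlgebraic.of_pow two_pos ?_
    rw [hsq]
    exact ((((hn 25).mul ((hp.add hr).pow 2)).sub ((hn 100).mul (hp.pow 2))).sub
      ((hn 100).mul (hr.pow 2))).sub ((hn 60).mul (hz a))
  have ht : IsAlgebraic R t := by
    have : t = ((20 : ℕ) : K)⁻¹ *
        ((20 * t - 5 * ((t + x) + (t + y))) + (5 : ℕ) * ((t + x) + (t + y))) := by
      push_cast; field_simp; ring
    rw [this]
    exact (hn 20).inv.mul (h1.add ((hn 5).mul (hp.add hr)))
  exact ⟨ht, by simpa using hp.sub ht, by simpa using hr.sub ht⟩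

/-- On the quadric, all coordinates are algebraic as soon as `t + x` and `t - x` are. -/
theorem isAlgebraic_of_quadric_of_add_of_sub (hq : 10 * t ^ 2 + 5 * x ^ 2 + 5 * y ^ 2 = -3 * a)
    (hp : IsAlgebraic R (t + x)) (hr : IsAlgebraic R (t - x)) :
    IsAlgebraic R t ∧ IsAlgebraic R x ∧ IsAlgebraic R y := by
  have hn : ∀ n : ℕ, IsAlgebraic R (n : K) := fun n => by
    simpa using isAlgebraic_algebraMap (R := R) (A := K) (n : R)
  have hz : ∀ n : ℤ, IsAlgebraic R (n : K) := isAlgebraic_intCast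
  have ht : IsAlgebraic R t := by
    have : t = ((2 : ℕ) : K)⁻¹ * ((t + x) + (t - x)) := by push_cast; field_simp; ring
    rw [this]
    exact (hn 2).inv.mul (hp.add hr)
  have hx : IsAlgebraic R x := by simpa using hp.sub ht
  refine ⟨ht, hx, IsAlgebraic.of_pow two_pos ?_⟩
  have : y ^ 2 = ((5 : ℕ) : K)⁻¹ * ((-3 : ℤ) * a - (10 : ℕ) * t ^ 2 - (5 : ℕ) * x ^ 2) := by
    push_cast; field_simp; linear_combination hq
  rw [this]
  exact (hn 5).inv.mul ((((hz _).mul (hz a)).sub ((hn 10).mul (ht.pow 2))).sub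
    ((hn 5).mul (hx.pow 2)))

end Algebraic

/-- A point of the quadric whose coordinates are not all algebraic over a subalgebra with one
generator gives a non-trivial point of the hypersurface. -/
theorem nonTrivialPoint_of_quadric {K : Type*} [Field K] [Algebra ℚ K] {a c : ℤ} {t x y : K}
    (hq : 10 * t ^ 2 + 5 * x ^ 2 + 5 * y ^ 2 = -3 * a)
    (hnot : ∀ w : K, ¬ (IsAlgebraic (Algebra.adjoin ℚ {w}) t ∧
      IsAlgebraic (Algebra.adjoin ℚ {w}) x ∧ IsAlgebraic (Algebra.adjoin ℚ {w}) y)) :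
    NonTrivialPoint (oddQuintic a c) (t + x) (t - x) (t + y) (t - y) := by
  have : CharZero K := algebraRat.charZero K
  have hself : ∀ w : K, IsAlgebraic (Algebra.adjoin ℚ {w}) w := fun w =>
    isAlgebraic_algebraMap (A := K)
      (⟨w, Algebra.subset_adjoin rfl⟩ : Algebra.adjoin ℚ {w})
  have hval : ∀ w : K, IsAlgebraic (Algebra.adjoin ℚ {w})
      (aeval w (oddQuintic a c)) := fun w => by
    rw [aeval_oddQuintic]
    exact (((hself w).pow 5).add ((isAlgebraic_intCast a).mul ((hself w).pow 3))).add
      ((isAlgebraic_intCast c).mul (hself w))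
  -- The quadric is invariant under sign changes of x and y, so one argument covers all four
  -- coincidences.
  have key : ∀ x' y', (x' = x ∨ x' = -x) → (y' = y ∨ y' = -y) →
      aeval (t + x') (oddQuintic a c) ≠ aeval (t + y') (oddQuintic a c) := by
    intro x' y' hx hy h
    have hq' : 10 * t ^ 2 + 5 * x' ^ 2 + 5 * y' ^ 2 = -3 * a := by
      rcases hx with rfl | rfl <;> rcases hy with rfl | rfl <;> linear_combination hq
    obtain ⟨h1, h2, h3⟩ := isAlgebraic_of_quadric hq' (hself (t + x'))
      (isAlgebraic_of_aeval_oddQuintic (h ▸ hval (t + x')))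
    refine hnot (t + x') ⟨h1, ?_, ?_⟩
    · rcases hx with rfl | rfl
      exacts [h2, by simpa using h2.neg]
    · rcases hy with rfl | rfl
      exacts [h3, by simpa using h3.neg]
  have hdisj : Disjoint ({aeval (t + x) (oddQuintic a c), aeval (t - x) (oddQuintic a c)} :
      Set K) {aeval (t + y) (oddQuintic a c), aeval (t - y) (oddQuintic a c)} := by
    simp only [sub_eq_add_neg]
    rw [Set.disjoint_left]
    rintro w (rfl | rfl) (h | h)
    exacts [key _ _ (.inl rfl) (.inl rfl) h, key _ _ (.inl rfl) (.inr rfl) h,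
      key _ _ (.inr rfl) (.inl rfl) h, key _ _ (.inr rfl) (.inr rfl) h]
  refine ⟨?_, hdisj, ?_⟩
  · rw [Set.disjoint_left] at hdisj ⊢
    rintro w hw hw'
    refine hdisj (a := aeval w (oddQuintic a c)) ?_ ?_
    · rcases hw with rfl | rfl <;> simp
    · rcases hw' with rfl | rfl <;> simp
  · intro h
    refine hnot (t + x) (isAlgebraic_of_quadric_of_add_of_sub hq (hself _)
      (isAlgebraic_of_aeval_oddQuintic (a := a) (c := c) ?_))
    rw [eq_neg_of_add_eq_zero_right h]
    exact (hval (t + x)).neg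

/-- A generic point of the quadric gives a two-parametric solution. -/
theorem isTwoParametricSolution_of_quadric {a c : ℤ} {t x y : TwoParamField}
    (hq : 10 * t ^ 2 + 5 * x ^ 2 + 5 * y ^ 2 = -3 * a)
    (hgen : IntermediateField.adjoin ℚ {t, x, y} = ⊤) :
    IsTwoParametricSolution (oddQuintic a c) (t + x) (t - x) (t + y) (t - y) := by
  have hon : OnHypersurface (oddQuintic a c) (t + x) (t - x) (t + y) (t - y) := by
    unfold OnHypersurface
    simp only [aeval_oddQuintic]
    linear_combination 2 * t * (x ^ 2 - y ^ 2) * hq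
  have hnot : ∀ w : TwoParamField, ¬ (IsAlgebraic (Algebra.adjoin ℚ {w}) t ∧
      IsAlgebraic (Algebra.adjoin ℚ {w}) x ∧ IsAlgebraic (Algebra.adjoin ℚ {w}) y) := by
    rintro w ⟨ht, hx, hy⟩
    obtain ⟨z, hz, hzn⟩ := TwoParamField.exists_not_isAlgebraic hgen w
    rcases hz with rfl | rfl | rfl
    exacts [hzn ht, hzn hx, hzn hy]
  refine ⟨hon, nonTrivialPoint_of_quadric hq hnot, ?_⟩
  · set E := IntermediateField.adjoin ℚ ({t + x, t - x, t + y, t - y} : Set TwoParamField)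
    have hp : t + x ∈ E := IntermediateField.subset_adjoin ℚ _ (by simp)
    have hm : t - x ∈ E := IntermediateField.subset_adjoin ℚ _ (by simp)
    have hr : t + y ∈ E := IntermediateField.subset_adjoin ℚ _ (by simp)
    have ht : t ∈ E := by
      have : t = ((t + x) + (t - x)) / (2 : ℕ) := by push_cast; field_simp; ring
      rw [this]
      exact div_mem (add_mem hp hm) (natCast_mem E 2)
    rw [eq_top_iff, ← hgen, IntermediateField.adjoin_le_iff]
    rintro w (rfl | rfl | rfl)
    exacts [ht, by simpa using sub_mem hp ht, by simpa using sub_mem hr ht]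

/-! ### Parametrization and conclusion. -/

/-- Stereographic projection: a rational point on the quadric yields a generic point over
`ℚ(u, v)`. -/
theorem exists_generic_point_on_quadric {a : ℤ} (ha : a ≠ 0) {t₀ x₀ y₀ : ℚ}
    (h₀ : 10 * t₀ ^ 2 + 5 * x₀ ^ 2 + 5 * y₀ ^ 2 = -3 * a) :
    ∃ t x y : TwoParamField, 10 * t ^ 2 + 5 * x ^ 2 + 5 * y ^ 2 = -3 * a ∧
      IntermediateField.adjoin ℚ {t, x, y} = ⊤ := by
  let ι := algebraMap (MvPolynomial (Fin 2) ℚ) TwoParamField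
  have hι : Function.Injective ι := IsFractionRing.injective _ _
  have hιC : ∀ r : ℚ, ι (MvPolynomial.C r) = (r : TwoParamField) :=
    map_ratCast (ι.comp MvPolynomial.C)
  obtain ⟨u, hu⟩ : ∃ u, u = ι (MvPolynomial.X 0) := ⟨_, rfl⟩
  obtain ⟨v, hv⟩ : ∃ v, v = ι (MvPolynomial.X 1) := ⟨_, rfl⟩
  have hD : 2 * u ^ 2 + v ^ 2 + 1 ≠ 0 := by
    intro h
    have h1 : (2 * MvPolynomial.X 0 ^ 2 + MvPolynomial.X 1 ^ 2 + 1 :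
        MvPolynomial (Fin 2) ℚ) = 0 := hι (by
      simpa only [hu, hv, map_add, map_mul, map_pow, map_one, map_zero, map_ofNat] using h)
    simpa using congrArg (MvPolynomial.eval fun _ => (0 : ℚ)) h1
  -- Vanishing would force t₀ = x₀ = y₀ = 0, hence a = 0.
  have hB : 2 * t₀ * u + x₀ * v + y₀ ≠ 0 := by
    intro h
    have h1 : (MvPolynomial.C (2 * t₀) * MvPolynomial.X 0 + MvPolynomial.C x₀ * MvPolynomial.X 1
        + MvPolynomial.C y₀ : MvPolynomial (Fin 2) ℚ) = 0 := hι (by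
      rw [map_add ι, map_add ι, map_mul ι, map_mul ι, hιC, hιC, hιC, ← hu, ← hv, map_zero]
      push_cast
      exact h)
    have e (w : Fin 2 → ℚ) : 2 * t₀ * w 0 + x₀ * w 1 + y₀ = 0 := by
      simpa using congrArg (MvPolynomial.eval w) h1
    have e0 := e ![0, 0]
    have e1 := e ![1, 0]
    have e2 := e ![0, 1]
    simp at e0 e1 e2
    subst e0
    simp at e1 e2
    subst e1 e2
    apply ha
    have : (a : ℚ) = 0 := by linarith
    exact_mod_cast this
  have h₀' : 10 * (t₀ : TwoParamField) ^ 2 + 5 * (x₀ : TwoParamField) ^ 2 +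
      5 * (y₀ : TwoParamField) ^ 2 = -3 * a := by
    exact_mod_cast congrArg (Rat.cast (K := TwoParamField)) h₀
  -- The second intersection of the quadric with the line through (t₀, x₀, y₀) in direction (u, v,
  -- 1).
  obtain ⟨l, hl⟩ : ∃ l, l = -2 * (2 * t₀ * u + x₀ * v + y₀) / (2 * u ^ 2 + v ^ 2 + 1) := ⟨_, rfl⟩
  have hl0 : l ≠ 0 := by
    rw [hl]
    exact div_ne_zero (mul_ne_zero (by norm_num) hB) hD
  have hlD : l * (2 * u ^ 2 + v ^ 2 + 1) = -2 * (2 * t₀ * u + x₀ * v + y₀) := by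
    rw [hl, div_mul_cancel₀ _ hD]
  refine ⟨t₀ + l * u, x₀ + l * v, y₀ + l, ?_, ?_⟩
  · linear_combination h₀' + 5 * l * hlD
  · set E := IntermediateField.adjoin ℚ
      ({t₀ + l * u, x₀ + l * v, y₀ + l} : Set TwoParamField)
    have hr : ∀ r : ℚ, (r : TwoParamField) ∈ E := fun r => SubfieldClass.ratCast_mem E r
    have ht : t₀ + l * u ∈ E := IntermediateField.subset_adjoin ℚ _ (by simp)
    have hx : x₀ + l * v ∈ E := IntermediateField.subset_adjoin ℚ _ (by simp)
    have hy : y₀ + l ∈ E := IntermediateField.subset_adjoin ℚ _ (by simp)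
    have hlE : l ∈ E := by simpa using sub_mem hy (hr y₀)
    have huE : u ∈ E := by simpa [hl0] using div_mem (sub_mem ht (hr t₀)) hlE
    have hvE : v ∈ E := by simpa [hl0] using div_mem (sub_mem hx (hr x₀)) hlE
    refine TwoParamField.eq_top_of_mem fun i => ?_
    fin_cases i
    · exact hu ▸ huE
    · exact hv ▸ hvE

theorem theorem2 (a c : ℤ) (ha : a < 0)
    (hmod : ∀ (k : ℕ) (b : ℤ), a = 4 ^ k * b →
      ¬ -b ≡ 2 [ZMOD 48] ∧ ¬ -b ≡ 18 [ZMOD 48] ∧ ¬ -b ≡ 34 [ZMOD 48]) :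
    ∃ p q r s : TwoParamField, IsTwoParametricSolution (oddQuintic a c) p q r s := by
  -- The classes 2, 18, 34 mod 48 together form the class 2 mod 16.
  obtain ⟨t₀, x₀, y₀, h₀⟩ := exists_rat_point_on_quadric ha fun k b hb => by
    have := hmod k b hb
    unfold Int.ModEq at this ⊢
    omega
  obtain ⟨t, x, y, hq, hgen⟩ := exists_generic_point_on_quadric ha.ne h₀
  exact ⟨_, _, _, _, isTwoParametricSolution_of_quadric hq hgen⟩
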